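/- Let $s=\{\xi\in\mathbb C^{\mathbb N}: |\xi|_q:=(\sum_{j\ge1}|\xi_j|^2j^{2q})^{1/2}<\infty \text{ for all } q\in\mathbb N_0\}$ be the Fréchet space of rapidly decreasing sequences, with the topology given by the norms $|\cdot|_q$, and let $s'=\{\xi\in\mathbb C^{\mathbb N}: |\xi|'_q:=(\sum_{j\ge1}|\xi_j|^2j^{-2q})^{1/2}<\infty \text{ for some } q\in\mathbb N_0\}$ be the space of slowly increasing sequences, with the (locally convex) inductive limit topology given by the norms $|\cdot|'_q$. Let $L(s',s)$ be the space of continuous linear operators from $s'$ to $s$, with the norms $\|x\|_q:=\sup_{|\xi|'_q\le1}|x\xi|_q$ $(q\in\mathbb N_0)$. Composition with the inclusions $\ell_2\hookrightarrow s'$ and $s\hookrightarrow\ell_2$ embeds $L(s',s)$ into the bounded operators on $\ell_2$; "$x\in L(s',s)$" for an operator $x$ on $\ell_2$ means that $x$ lies in the image of this embedding, and $\|x\|_q$ is then the norm of its (unique) preimage. Let $x$ be a compact, infinite-dimensional (that is, not of finite rank), normal operator on $\ell_2$ with spectral representation $x=\sum_{n=1}^\infty\lambda_nP_n$: the series converges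 in the operator norm of $\ell_2$, the $\lambda_n$ are pairwise different nonzero complex numbers with $|\lambda_1|\ge|\lambda_2|\ge\cdots$, and the $P_n$ are nonzero, pairwise orthogonal, finite-dimensional orthogonal projections on $\ell_2$. Then the following assertions are equivalent: 1. $x\in L(s',s)$; 2. $P_n\in L(s',s)$ for all $n\in\mathbb N$, and $(|\lambda_n|^\theta\|P_n\|_q)_{n\in\mathbb N}\in s$ for all $q\in\mathbb N_0$ and all $\theta\in(0,1]$; 3. $P_n\in L(s',s)$ for all $n\in\mathbb N$, $(\lambda_n)_{n\in\mathbb N}\in s$, and $\sup_{n\in\mathbb N}|\lambda_n|\,\|P_n\|_q<\infty$ for all $q\in\mathbb N_0$; 4. $P_n\in L(s',s)$ for all $n\in\mathbb N$, and $\sum_{n=1}^\infty|\lambda_n|\,\|P_n\|_q<\infty$ for all $q\in\mathbb N_0$. Moreover, if $x=\sum_{n=1}^N\lambda_nP_n$ is a finite-dimensional operator on $\ell_2$, where the $\lambda_n$ are pairwise different nonzero complex numbers and the $P_n$ are nonzero, pairwise orthogonal, finite-dimensional orthogonal projections on $\ell_2$, then $x\in L(s',s)$ if and only if $P_n\in L(s',s)$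 for $n=1,\dots,N$. -/

import Mathlib

open scoped lp ENNReal Topology

namespace SmoothOperators

noncomputable section

/- Sequences are indexed by `ℕ = {0, 1, 2, …}`; the entry with index `j` is the entry number
`j + 1` of a sequence numbered by `1, 2, 3, …`, so its weight is a power of `j + 1`. -/

/-- The sequences `ξ` with `∑ |ξ_j|² j^{2k} < ∞` (`j = 1, 2, …`), for an integer `k`. -/
def weightedSubmodule (k : ℤ) : Submodule ℂ (ℕ → ℂ) where
  carrier := {ξ | Summable fun j : ℕ => ‖ξ j‖ ^ 2 * ((j : ℝ) + 1) ^ (2 * k)}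
  zero_mem' := by simp [summable_zero]
  add_mem' := by
    intro ξ η hξ hη
    refine Summable.of_nonneg_of_le (fun j => by positivity) (fun j => ?_)
      ((hξ.mul_left 2).add (hη.mul_left 2))
    have h1 : ‖ξ j + η j‖ ^ 2 ≤ 2 * ‖ξ j‖ ^ 2 + 2 * ‖η j‖ ^ 2 := by
      have := norm_add_le (ξ j) (η j)
      have h0 := norm_nonneg (ξ j + η j)
      nlinarith [sq_nonneg (‖ξ j‖ - ‖η j‖)]
    have h2 : (0 : ℝ) ≤ ((j : ℝ) + 1) ^ (2 * k) := by positivity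
    calc ‖(ξ + η) j‖ ^ 2 * ((j : ℝ) + 1) ^ (2 * k)
        ≤ (2 * ‖ξ j‖ ^ 2 + 2 * ‖η j‖ ^ 2) * ((j : ℝ) + 1) ^ (2 * k) :=
          mul_le_mul_of_nonneg_right h1 h2
      _ = _ := by ring
  smul_mem' := by
    intro c ξ hξ
    refine (hξ.mul_left (‖c‖ ^ 2)).congr (fun j => ?_)
    simp only [Pi.smul_apply, smul_eq_mul, norm_mul]
    ring

/-- The weighted Hilbert space of all `ξ` with `(∑ |ξ_j|² j^{2k})^{1/2} < ∞`. -/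
def Weighted (k : ℤ) : Type := ↥(weightedSubmodule k)

namespace Weighted

variable {k : ℤ}

instance : AddCommGroup (Weighted k) := inferInstanceAs (AddCommGroup ↥(weightedSubmodule k))
instance : Module ℂ (Weighted k) := inferInstanceAs (Module ℂ ↥(weightedSubmodule k))
instance : CoeFun (Weighted k) (fun _ => ℕ → ℂ) := ⟨fun ξ => ξ.1⟩

theorem ext' {ξ η : Weighted k} (h : ∀ j, ξ j = η j) : ξ = η := Subtype.ext (funext h)

/-- `(∑ |ξ_j|² j^{2k})^{1/2}`: the norm `|ξ|_q` for `k = q` and `|ξ|'_q` for `k = -q`. -/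
instance : Norm (Weighted k) :=
  ⟨fun ξ => Real.sqrt (∑' j : ℕ, ‖ξ j‖ ^ 2 * ((j : ℝ) + 1) ^ (2 * k))⟩

theorem norm_def (ξ : Weighted k) :
    ‖ξ‖ = Real.sqrt (∑' j : ℕ, ‖ξ j‖ ^ 2 * ((j : ℝ) + 1) ^ (2 * k)) := rfl

theorem norm_weight_mul (z : ℂ) (j : ℕ) :
    ‖((j : ℂ) + 1) ^ k * z‖ ^ 2 = ‖z‖ ^ 2 * ((j : ℝ) + 1) ^ (2 * k) := by
  have h : ‖(j : ℂ) + 1‖ = (j : ℝ) + 1 := by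
    have := Complex.norm_natCast (j + 1)
    push_cast at this
    exact this
  rw [norm_mul, norm_zpow, h, mul_pow, mul_comm 2 k, zpow_mul, zpow_ofNat]
  ring

/-- The isometric identification with a subspace of `ℓ²` by multiplication with the weights. -/
def toL2 : Weighted k →ₗ[ℂ] ℓ²(ℕ, ℂ) where
  toFun ξ := ⟨fun j => ((j : ℂ) + 1) ^ k * ξ j, by
    refine (memℓp_gen_iff (by norm_num)).2 ?_
    have h := ξ.2
    refine Summable.congr h (fun j => ?_)
    have := norm_weight_mul (k := k) (ξ j) j
    rw [← this]
    norm_num⟩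
  map_add' ξ η := by
    ext j
    exact mul_add _ _ _
  map_smul' c ξ := by
    ext j
    exact mul_left_comm _ _ _

theorem norm_toL2 (ξ : Weighted k) : ‖toL2 ξ‖ = ‖ξ‖ := by
  rw [norm_def, lp.norm_eq_tsum_rpow (by norm_num), Real.sqrt_eq_rpow]
  norm_num
  congr 1
  refine tsum_congr (fun j => ?_)
  rw [← norm_weight_mul]
  rfl

theorem toL2_injective : Function.Injective (toL2 (k := k)) := by
  intro ξ η h
  refine ext' fun j => ?_
  have h1 : ((j : ℂ) + 1) ^ k * ξ j = ((j : ℂ) + 1) ^ k * η j :=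
    congrArg (fun z : ℓ²(ℕ, ℂ) => z j) h
  exact mul_left_cancel₀ (zpow_ne_zero _ (Nat.cast_add_one_ne_zero j)) h1

theorem normedSpaceCore : NormedSpace.Core ℂ (Weighted k) where
  norm_nonneg ξ := Real.sqrt_nonneg _
  norm_smul c ξ := by rw [← norm_toL2, ← norm_toL2, map_smul, norm_smul]
  norm_triangle ξ η := by
    rw [← norm_toL2, ← norm_toL2, ← norm_toL2, map_add]
    exact norm_add_le _ _
  norm_eq_zero_iff ξ := by
    rw [← norm_toL2, norm_eq_zero, map_eq_zero_iff _ toL2_injective]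

instance : NormedAddCommGroup (Weighted k) := NormedAddCommGroup.ofCore normedSpaceCore
instance : NormedSpace ℂ (Weighted k) := NormedSpace.ofCore normedSpaceCore

end Weighted

/-- The rapidly decreasing sequences: `∑ |ξ_j|² j^{2q} < ∞` for all `q`. -/
def rapidSubmodule : Submodule ℂ (ℕ → ℂ) := ⨅ q : ℕ, weightedSubmodule q

theorem mem_rapidSubmodule {ξ : ℕ → ℂ} : ξ ∈ rapidSubmodule ↔
    ∀ q : ℕ, Summable fun j : ℕ => ‖ξ j‖ ^ 2 * ((j : ℝ) + 1) ^ (2 * (q : ℤ)) := by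
  simp only [rapidSubmodule, Submodule.mem_iInf]
  rfl

/-- The space `s` of rapidly decreasing sequences. -/
def RapidSeq : Type := ↥rapidSubmodule

namespace RapidSeq

instance : AddCommGroup RapidSeq := inferInstanceAs (AddCommGroup ↥rapidSubmodule)
instance : Module ℂ RapidSeq := inferInstanceAs (Module ℂ ↥rapidSubmodule)
instance : Module ℝ RapidSeq := inferInstanceAs (Module ℝ ↥rapidSubmodule)
instance : IsScalarTower ℝ ℂ RapidSeq := inferInstanceAs (IsScalarTower ℝ ℂ ↥rapidSubmodule)
instance : CoeFun RapidSeq (fun _ => ℕ → ℂ) := ⟨fun ξ => ξ.1⟩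

/-- The inclusion of `s` into the weighted space with weights `j^q`. -/
def toWeightedₗ (q : ℕ) : RapidSeq →ₗ[ℂ] Weighted q where
  toFun ξ := ⟨ξ.1, mem_rapidSubmodule.1 ξ.2 q⟩
  map_add' _ _ := rfl
  map_smul' _ _ := rfl

/-- The norms `|ξ|_q = (∑ |ξ_j|² j^{2q})^{1/2}` on `s`. -/
def seminorms : SeminormFamily ℂ RapidSeq ℕ := fun q =>
  (normSeminorm ℂ (Weighted q)).comp (toWeightedₗ q)

theorem seminorms_apply (q : ℕ) (ξ : RapidSeq) :
    seminorms q ξ = Real.sqrt (∑' j : ℕ, ‖ξ j‖ ^ 2 * ((j : ℝ) + 1) ^ (2 * (q : ℤ))) := rfl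

/-- The topology of `s` is the one defined by the norms `|·|_q`. -/
instance : TopologicalSpace RapidSeq := seminorms.moduleFilterBasis.topology

theorem withSeminorms : WithSeminorms seminorms := ⟨rfl⟩

instance : IsTopologicalAddGroup RapidSeq := withSeminorms.topologicalAddGroup
instance : ContinuousSMul ℂ RapidSeq := withSeminorms.continuousSMul
instance : LocallyConvexSpace ℝ RapidSeq := withSeminorms.toLocallyConvexSpace

/-- The continuous inclusion of `s` into the weighted space with weights `j^q`. -/
def toWeighted (q : ℕ) : RapidSeq →L[ℂ] Weighted q where
  toLinearMap := toWeightedₗ q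
  cont := by
    refine (norm_withSeminorms ℂ (Weighted q)).continuous_of_continuous_comp _ fun _ => ?_
    exact withSeminorms.continuous_seminorm q

end RapidSeq

theorem weightedSubmodule_mono {k l : ℤ} (h : k ≤ l) :
    weightedSubmodule l ≤ weightedSubmodule k := by
  intro ξ hξ
  refine Summable.of_nonneg_of_le (fun j => by positivity) (fun j => ?_) hξ
  refine mul_le_mul_of_nonneg_left ?_ (by positivity)
  exact zpow_le_zpow_right₀ (by linarith [Nat.cast_nonneg (α := ℝ) j]) (by omega)

/-- The slowly increasing sequences: `∑ |ξ_j|² j^{-2q} < ∞` for some `q`. -/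
def slowSubmodule : Submodule ℂ (ℕ → ℂ) where
  carrier := {ξ | ∃ q : ℕ, ξ ∈ weightedSubmodule (-(q : ℤ))}
  zero_mem' := ⟨0, Submodule.zero_mem _⟩
  add_mem' := by
    rintro ξ η ⟨p, hp⟩ ⟨q, hq⟩
    exact ⟨max p q, Submodule.add_mem _
      (weightedSubmodule_mono (by simp) hp) (weightedSubmodule_mono (by simp) hq)⟩
  smul_mem' := by
    rintro c ξ ⟨q, hq⟩
    exact ⟨q, Submodule.smul_mem _ c hq⟩

/-- The space `s'` of slowly increasing sequences. -/
def SlowSeq : Type := ↥slowSubmodule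

namespace SlowSeq

instance : AddCommGroup SlowSeq := inferInstanceAs (AddCommGroup ↥slowSubmodule)
instance : Module ℂ SlowSeq := inferInstanceAs (Module ℂ ↥slowSubmodule)
instance : Module ℝ SlowSeq := inferInstanceAs (Module ℝ ↥slowSubmodule)
instance : IsScalarTower ℝ ℂ SlowSeq := inferInstanceAs (IsScalarTower ℝ ℂ ↥slowSubmodule)
instance : CoeFun SlowSeq (fun _ => ℕ → ℂ) := ⟨fun ξ => ξ.1⟩

/-- The inclusion into `s'` of the Hilbert space of all `ξ` with `|ξ|'_q < ∞`. -/
def ofWeightedₗ (q : ℕ) : Weighted (-(q : ℤ)) →ₗ[ℂ] SlowSeq where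
  toFun ξ := ⟨ξ.1, q, ξ.2⟩
  map_add' _ _ := rfl
  map_smul' _ _ := rfl

/-- The inductive limit topology of `s'`: the finest locally convex vector space topology for which
the inclusions of the Hilbert spaces `{ξ | |ξ|'_q < ∞}` are continuous. -/
instance : TopologicalSpace SlowSeq :=
  sInf {t : TopologicalSpace SlowSeq |
    (∀ q : ℕ, @Continuous _ _ _ t (ofWeightedₗ q)) ∧
    @IsTopologicalAddGroup SlowSeq t _ ∧
    @ContinuousSMul ℂ SlowSeq _ _ t ∧
    @LocallyConvexSpace ℝ SlowSeq _ _ _ _ t}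

instance : IsTopologicalAddGroup SlowSeq := topologicalAddGroup_sInf fun _ h => h.2.1
instance : ContinuousSMul ℂ SlowSeq := continuousSMul_sInf fun _ h => h.2.2.1
instance : LocallyConvexSpace ℝ SlowSeq := LocallyConvexSpace.sInf fun _ h => h.2.2.2

/-- The continuous inclusion into `s'` of the Hilbert space of all `ξ` with `|ξ|'_q < ∞`. -/
def ofWeighted (q : ℕ) : Weighted (-(q : ℤ)) →L[ℂ] SlowSeq where
  toLinearMap := ofWeightedₗ q
  cont := continuous_sInf_rng.2 fun _ h => h.1 q

end SlowSeq

/-- `L(s', s)`: the continuous linear operators from `s'` to `s`. -/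
abbrev SmoothOp : Type := SlowSeq →L[ℂ] RapidSeq

/-- `ℓ²` is the space of all `ξ` with `|ξ|'_0 < ∞`. -/
def l2ToWeighted : ℓ²(ℕ, ℂ) →ₗ[ℂ] Weighted (-((0 : ℕ) : ℤ)) where
  toFun ξ := ⟨fun j => ξ j, by
    have h := (memℓp_gen_iff (p := 2) (by norm_num)).1 (lp.memℓp ξ)
    refine Summable.congr h (fun j => ?_)
    norm_num⟩
  map_add' _ _ := rfl
  map_smul' _ _ := rfl

/-- The continuous inclusion `ℓ² → s'`. -/
def l2ToSlow : ℓ²(ℕ, ℂ) →L[ℂ] SlowSeq :=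
  (SlowSeq.ofWeighted 0).comp <| l2ToWeighted.mkContinuous 1 (by
    intro ξ
    rw [← Weighted.norm_toL2, one_mul]
    refine le_of_eq (congrArg norm ?_)
    ext j
    change ((j : ℂ) + 1) ^ (-((0 : ℕ) : ℤ)) * ξ j = ξ j
    simp)

/-- The continuous inclusion `s → ℓ²`. -/
def rapidToL2 : RapidSeq →L[ℂ] ℓ²(ℕ, ℂ) :=
  (LinearMap.mkContinuous (Weighted.toL2 (k := ((0 : ℕ) : ℤ))) 1
    (fun ξ => by rw [one_mul, Weighted.norm_toL2])).comp (RapidSeq.toWeighted 0)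

theorem l2ToSlow_apply (ξ : ℓ²(ℕ, ℂ)) (j : ℕ) : l2ToSlow ξ j = ξ j := rfl

theorem rapidToL2_apply (ξ : RapidSeq) (j : ℕ) : rapidToL2 ξ j = ξ j := by
  change ((j : ℂ) + 1) ^ ((0 : ℕ) : ℤ) * ξ j = ξ j
  simp

/-- The canonical embedding `L(s', s) → L(ℓ²)`, which sends `T` to the composition
`ℓ² → s' → s → ℓ²` of `T` with the two inclusions. -/
def embed (T : SmoothOp) : ℓ²(ℕ, ℂ) →L[ℂ] ℓ²(ℕ, ℂ) := rapidToL2.comp (T.comp l2ToSlow)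

/-- The norm `‖T‖_q = sup {|T ξ|_q : |ξ|'_q ≤ 1}` on `L(s', s)`. -/
def smoothNorm (q : ℕ) (T : SmoothOp) : ℝ :=
  ⨆ ξ : {ξ : Weighted (-(q : ℤ)) // ‖ξ‖ ≤ 1}, RapidSeq.seminorms q (T (SlowSeq.ofWeighted q ξ.1))

theorem bddAbove_smoothNorm (q : ℕ) (T : SmoothOp) : BddAbove (Set.range fun
    ξ : {ξ : Weighted (-(q : ℤ)) // ‖ξ‖ ≤ 1} =>
      RapidSeq.seminorms q (T (SlowSeq.ofWeighted q ξ.1))) := by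
  refine ⟨‖(RapidSeq.toWeighted q).comp (T.comp (SlowSeq.ofWeighted q))‖, ?_⟩
  rintro _ ⟨ξ, rfl⟩
  exact ((RapidSeq.toWeighted q).comp (T.comp (SlowSeq.ofWeighted q))).unit_le_opNorm ξ.1 ξ.2

/-- The unit vectors. -/
def Weighted.unit (k : ℤ) (j : ℕ) : Weighted k :=
  ⟨Pi.single j 1, summable_of_ne_finset_zero (s := {j}) (fun i hi => by
    have : i ≠ j := by simpa using hi
    simp [Pi.single_eq_of_ne this])⟩

theorem Weighted.toL2_unit (k : ℤ) (j : ℕ) :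
    toL2 (unit k j) = ((j : ℂ) + 1) ^ k • lp.single 2 j (1 : ℂ) := by
  ext i
  change ((i : ℂ) + 1) ^ k * (Pi.single j 1 : ℕ → ℂ) i =
    ((j : ℂ) + 1) ^ k * (lp.single 2 j (1 : ℂ) : ℓ²(ℕ, ℂ)) i
  rw [lp.coeFn_single]
  by_cases h : i = j
  · subst h; simp
  · simp [Pi.single_eq_of_ne h]

theorem Weighted.hasSum_unit {k : ℤ} (ξ : Weighted k) : HasSum (fun j => ξ j • unit k j) ξ := by
  have hi : Topology.IsInducing (toL2 (k := k)) :=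
    (AddMonoidHomClass.isometry_of_norm _ norm_toL2).isUniformInducing.isInducing
  rw [← hi.hasSum_iff]
  convert lp.hasSum_single (p := 2) (by norm_num) (toL2 ξ) using 1
  funext j
  simp only [Function.comp_apply, map_smul, toL2_unit, smul_smul]
  rw [← lp.single_smul]
  congr 1
  change ξ j * ((j : ℂ) + 1) ^ k * 1 = ((j : ℂ) + 1) ^ k * ξ j
  ring

/-- The embedding is injective, so an operator on `ℓ²` is induced by at most one element of
`L(s', s)`. -/
theorem embed_injective : Function.Injective embed := by
  intro T S h
  refine ContinuousLinearMap.ext fun ξ => ?_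
  obtain ⟨ξ, q, hq⟩ := ξ
  let A (R : SmoothOp) : Weighted (-(q : ℤ)) →L[ℂ] ℓ²(ℕ, ℂ) :=
    rapidToL2.comp (R.comp (SlowSeq.ofWeighted q))
  have hu : ∀ (R : SmoothOp) j, A R (Weighted.unit _ j) = embed R (lp.single 2 j (1 : ℂ)) := by
    intro R j
    change rapidToL2 (R _) = rapidToL2 (R _)
    congr 2
  have hA : A T ⟨ξ, hq⟩ = A S ⟨ξ, hq⟩ := by
    have h1 := (Weighted.hasSum_unit ⟨ξ, hq⟩).mapL (A T)
    have h2 := (Weighted.hasSum_unit ⟨ξ, hq⟩).mapL (A S)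
    simp only [map_smul, hu] at h1 h2
    rw [h] at h1
    exact h1.unique h2
  refine Subtype.ext (funext fun j => ?_)
  have h3 := congrArg (fun z : ℓ²(ℕ, ℂ) => z j) hA
  exact (rapidToL2_apply _ j).symm.trans (h3.trans (rapidToL2_apply _ j))

/-- An operator on `ℓ²` belongs to `L(s', s)`. -/
def IsSmooth (x : ℓ²(ℕ, ℂ) →L[ℂ] ℓ²(ℕ, ℂ)) : Prop := x ∈ Set.range embed

/-- `lam` and `P` are the nonzero eigenvalues and the projections of a spectral representation:
pairwise different nonzero complex numbers, and pairwise orthogonal nonzero (orthogonal)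
projections of finite rank. -/
structure IsSpectralSystem {ι : Type*} (lam : ι → ℂ) (P : ι → ℓ²(ℕ, ℂ) →L[ℂ] ℓ²(ℕ, ℂ)) : Prop where
  lam_ne_zero : ∀ n, lam n ≠ 0
  lam_injective : Function.Injective lam
  isProj : ∀ n, IsStarProjection (P n)
  P_ne_zero : ∀ n, P n ≠ 0
  finiteDim : ∀ n, FiniteDimensional ℂ (LinearMap.range (P n).toLinearMap)
  orthogonal : ∀ m n, m ≠ n → (P m).comp (P n) = 0

end

end SmoothOperators

open SmoothOperators

/-! An operator on `ℓ²` lies in `L(s', s)` exactly when its matrix decays rapidly: `|x_ij| i^q j^q`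
is bounded for every `q` (`isSmooth_iff_entryBound`). Moreover `‖·‖_q` dominates the entry bound of
order `q` and is dominated, up to a constant, by the one of order `q + 2` (`entryBound_embed`,
`smoothNorm_le_of_entryBound`). Everything is then done on matrix entries.

Three estimates carry the equivalence. First, the entries of a projection have modulus at most 1, so
`|P_ij|^k ≤ |P_ij|`; this gives `‖P‖_q^k ≤ K ‖P‖_r` with `K` and `r` independent of `P`
(`exists_smoothNorm_pow_le`). Second, `λ² P = x P x` and `‖P‖ ≤ 1` on `ℓ²` bound `|λ|² ‖P‖_q`
uniformly over the spectral projections (`IsSmooth.exists_smoothNorm_bound`). Third, Bessel's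
inequality for unit eigenvectors, summed over the coordinates, makes the eigenvalues decay rapidly
(`IsSmooth.eigenvalues_rapid`).

Together they give 1 → 2: a high power of `|λ_n|^θ ‖P_n‖_q` splits into bounded factors and one
rapidly decreasing factor. For 2 → 3, take `θ = 1` and use `‖P_n‖_0 ≥ 1`. The case `k = 2` of the
first estimate gives 3 → 4, and 4 → 1 is a termwise bound on matrix entries. The finite-dimensional
case uses `λ² P = x P x` and linearity. -/

namespace SmoothOperators

/-! ### Coordinates, and matrix entries bounded by the norms of `L(s', s)` -/

/-- The unit vectors of `ℓ²`. -/
noncomputable def basisVec (j : ℕ) : ℓ²(ℕ, ℂ) := lp.single 2 j (1 : ℂ)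

/-- The matrix of `x` satisfies `|x_{ij}| i^q j^q ≤ C`. -/
def EntryBound (x : ℓ²(ℕ, ℂ) →L[ℂ] ℓ²(ℕ, ℂ)) (q : ℕ) (C : ℝ) : Prop :=
  ∀ i j : ℕ, ‖x (basisVec j) i‖ * (((i : ℝ) + 1) ^ q * ((j : ℝ) + 1) ^ q) ≤ C

theorem norm_basisVec (j : ℕ) : ‖basisVec j‖ = 1 := by
  simp [basisVec, lp.norm_single]

theorem inner_basisVec_left (j : ℕ) (v : ℓ²(ℕ, ℂ)) : inner ℂ (basisVec j) v = v j := by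
  simp [basisVec, lp.inner_single_left]

theorem norm_coord_le (v : ℓ²(ℕ, ℂ)) (j : ℕ) : ‖v j‖ ≤ ‖v‖ :=
  lp.norm_apply_le_norm (by norm_num) v j

theorem hasSum_sq_norm (v : ℓ²(ℕ, ℂ)) : HasSum (fun j => ‖v j‖ ^ 2) (‖v‖ ^ 2) := by
  have h := lp.hasSum_norm (p := 2) (by norm_num) v
  norm_num at h
  exact h

theorem Weighted.norm_coord_mul_le {k : ℤ} (ξ : Weighted k) (j : ℕ) :
    ‖ξ j‖ * ((j : ℝ) + 1) ^ k ≤ ‖ξ‖ := by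
  have h := norm_coord_le (toL2 ξ) j
  rw [norm_toL2] at h
  refine le_trans (le_of_eq ?_) h
  have h2 := norm_weight_mul (k := k) (ξ j) j
  rw [mul_comm 2 k, zpow_mul, zpow_ofNat, ← mul_pow] at h2
  exact ((pow_left_inj₀ (norm_nonneg _) (by positivity) two_ne_zero).1 h2).symm

theorem Weighted.norm_unit (k : ℤ) (j : ℕ) : ‖unit k j‖ = ((j : ℝ) + 1) ^ k := by
  rw [← norm_toL2, toL2_unit, norm_smul, norm_zpow]
  change _ * ‖basisVec j‖ = _
  have h : ‖(j : ℂ) + 1‖ = (j : ℝ) + 1 := by exact_mod_cast Complex.norm_natCast (j + 1)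
  rw [norm_basisVec, h, mul_one]

theorem l2ToSlow_basisVec (q j : ℕ) :
    l2ToSlow (basisVec j) = SlowSeq.ofWeighted q (Weighted.unit _ j) := rfl

theorem seminorms_eq (q : ℕ) (ξ : RapidSeq) :
    RapidSeq.seminorms q ξ = ‖RapidSeq.toWeighted q ξ‖ := rfl

theorem smoothNorm_nonneg (q : ℕ) (T : SmoothOp) : 0 ≤ smoothNorm q T :=
  Real.iSup_nonneg fun _ => apply_nonneg _ _

theorem seminorms_le_smoothNorm (q : ℕ) (T : SmoothOp) (ξ : Weighted (-(q : ℤ))) :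
    RapidSeq.seminorms q (T (SlowSeq.ofWeighted q ξ)) ≤ smoothNorm q T * ‖ξ‖ := by
  have hs := smoothNorm_nonneg q T
  rcases eq_or_ne ξ 0 with rfl | h0
  · simp
  have hn : 0 < ‖ξ‖ := norm_pos_iff.2 h0
  have h1 := le_ciSup (bddAbove_smoothNorm q T) ⟨((‖ξ‖⁻¹ : ℝ) : ℂ) • ξ, by
    rw [norm_smul, Complex.norm_real, norm_inv, norm_norm, inv_mul_cancel₀ hn.ne']⟩
  simp only [map_smul] at h1
  rw [map_smul_eq_mul, Complex.norm_real, norm_inv, norm_norm, inv_mul_le_iff₀ hn] at h1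
  rw [mul_comm]
  exact h1

theorem norm_embed_basisVec_mul_le (q : ℕ) (T : SmoothOp) (j : ℕ) :
    RapidSeq.seminorms q (T (l2ToSlow (basisVec j))) * ((j : ℝ) + 1) ^ q ≤ smoothNorm q T := by
  have h := seminorms_le_smoothNorm q T (Weighted.unit _ j)
  rw [Weighted.norm_unit, zpow_neg, zpow_natCast, ← div_eq_mul_inv,
    le_div_iff₀ (by positivity)] at h
  rwa [l2ToSlow_basisVec q]

/-- The unit vector `e_j` has `|e_j|'_q = j^{-q}`, and the `i`-th coordinate of `T e_j` is at most
`|T e_j|_q i^{-q}`. -/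
theorem entryBound_embed (q : ℕ) (T : SmoothOp) : EntryBound (embed T) q (smoothNorm q T) := by
  intro i j
  refine le_trans ?_ (norm_embed_basisVec_mul_le q T j)
  rw [← mul_assoc]
  refine mul_le_mul_of_nonneg_right ?_ (by positivity)
  have h := Weighted.norm_coord_mul_le (RapidSeq.toWeighted q (T (l2ToSlow (basisVec j)))) i
  rw [zpow_natCast] at h
  rw [seminorms_eq]
  refine le_trans (le_of_eq ?_) h
  congr 2
  exact rapidToL2_apply _ _

theorem norm_rapidToL2_le (q : ℕ) (ξ : RapidSeq) : ‖rapidToL2 ξ‖ ≤ RapidSeq.seminorms q ξ := by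
  have h0 := hasSum_sq_norm (rapidToL2 ξ)
  simp only [rapidToL2_apply] at h0
  rw [RapidSeq.seminorms_apply]
  refine Real.le_sqrt_of_sq_le ?_
  rw [← h0.tsum_eq]
  refine h0.summable.tsum_le_tsum (fun j => ?_) (mem_rapidSubmodule.1 ξ.2 q)
  refine le_mul_of_one_le_right (by positivity) ?_
  exact one_le_zpow₀ (by linarith [Nat.cast_nonneg (α := ℝ) j]) (by omega)

theorem norm_apply_basisVec_mul_le (q : ℕ) (T : SmoothOp) (j : ℕ) :
    ‖embed T (basisVec j)‖ * ((j : ℝ) + 1) ^ q ≤ smoothNorm q T :=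
  le_trans (mul_le_mul_of_nonneg_right (norm_rapidToL2_le q _) (by positivity))
    (norm_embed_basisVec_mul_le q T j)

/-! ### Rapidly decreasing matrices are the operators in `L(s', s)` -/

theorem summable_inv_sq : Summable fun j : ℕ => (((j : ℝ) + 1) ^ 2)⁻¹ := by
  have h := (summable_nat_add_iff (f := fun n : ℕ => (((n : ℝ)) ^ 2)⁻¹) 1).2
    (Real.summable_nat_pow_inv.2 one_lt_two)
  simpa using h

/-- The constant `∑ j⁻²`. -/
noncomputable def zetaTwo : ℝ := ∑' j : ℕ, (((j : ℝ) + 1) ^ 2)⁻¹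

theorem zetaTwo_nonneg : 0 ≤ zetaTwo := tsum_nonneg fun _ => by positivity

/-- Sup-type and square-sum-type weights define the same space: one extra power of the index pays
for the convergent series `∑ j⁻²`. -/
theorem mem_rapidSubmodule_iff_bounded {f : ℕ → ℂ} : f ∈ rapidSubmodule ↔
    ∀ m : ℕ, ∃ C : ℝ, ∀ n, ‖f n‖ * ((n : ℝ) + 1) ^ m ≤ C := by
  constructor
  · intro h m
    refine ⟨‖RapidSeq.toWeighted m ⟨f, h⟩‖, fun n => ?_⟩
    have := Weighted.norm_coord_mul_le (k := (m : ℤ)) (RapidSeq.toWeighted m ⟨f, h⟩) n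
    rw [zpow_natCast] at this
    exact this
  · intro h
    refine mem_rapidSubmodule.2 fun q => ?_
    obtain ⟨C, hC⟩ := h (q + 1)
    refine Summable.of_nonneg_of_le (fun j => by positivity) (fun j => ?_)
      (summable_inv_sq.mul_left (C ^ 2))
    have h1 := pow_le_pow_left₀ (by positivity) (hC j) 2
    rw [← div_eq_mul_inv, le_div_iff₀ (by positivity)]
    refine le_trans (le_of_eq ?_) h1
    rw [mul_comm 2 (q : ℤ), zpow_mul, zpow_natCast, zpow_ofNat]
    ring

/-- A kernel with `|a_{ij}| i^r j^r ≤ C`, applied to a sequence with `|ξ|'_q < ∞`. -/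
theorem kernel_summable_and_bound {a : ℕ → ℕ → ℂ} {r q : ℕ} {C : ℝ} (hr : q + 2 ≤ r)
    (ha : ∀ i j : ℕ, ‖a i j‖ * (((i : ℝ) + 1) ^ r * ((j : ℝ) + 1) ^ r) ≤ C)
    (ξ : Weighted (-(q : ℤ))) (i : ℕ) :
    Summable (fun j => a i j * ξ j) ∧
      ‖∑' j, a i j * ξ j‖ * ((i : ℝ) + 1) ^ r ≤ zetaTwo * C * ‖ξ‖ := by
  have hC : 0 ≤ C := le_trans (by positivity) (ha 0 0)
  have hb : ∀ j, ‖a i j * ξ j‖ ≤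
      (C * ‖ξ‖ * (((i : ℝ) + 1) ^ r)⁻¹) * (((j : ℝ) + 1) ^ 2)⁻¹ := by
    intro j
    have h1 := Weighted.norm_coord_mul_le ξ j
    rw [zpow_neg, zpow_natCast, ← div_eq_mul_inv, div_le_iff₀ (by positivity)] at h1
    -- Of the `r` powers of `j`, `q` absorb the growth of `ξ` and two make the series in `j`
    -- converge.
    have h2 : ((j : ℝ) + 1) ^ q * ((j : ℝ) + 1) ^ 2 ≤ ((j : ℝ) + 1) ^ r := by
      rw [← pow_add]
      exact pow_le_pow_right₀ (by linarith [Nat.cast_nonneg (α := ℝ) j]) hr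
    rw [norm_mul, ← div_eq_mul_inv, ← div_eq_mul_inv, div_div, le_div_iff₀ (by positivity)]
    calc ‖a i j‖ * ‖ξ j‖ * (((i : ℝ) + 1) ^ r * ((j : ℝ) + 1) ^ 2)
        ≤ ‖a i j‖ * (‖ξ‖ * ((j : ℝ) + 1) ^ q) * (((i : ℝ) + 1) ^ r * ((j : ℝ) + 1) ^ 2) := by
          gcongr
      _ = ‖a i j‖ * ‖ξ‖ * ((i : ℝ) + 1) ^ r * (((j : ℝ) + 1) ^ q * ((j : ℝ) + 1) ^ 2) := by ring
      _ ≤ ‖a i j‖ * ‖ξ‖ * ((i : ℝ) + 1) ^ r * ((j : ℝ) + 1) ^ r := by gcongr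
      _ = (‖a i j‖ * (((i : ℝ) + 1) ^ r * ((j : ℝ) + 1) ^ r)) * ‖ξ‖ := by ring
      _ ≤ C * ‖ξ‖ := by gcongr; exact ha i j
  have hs := summable_inv_sq.mul_left (C * ‖ξ‖ * (((i : ℝ) + 1) ^ r)⁻¹)
  refine ⟨Summable.of_norm_bounded hs hb, ?_⟩
  have h3 := tsum_of_norm_bounded hs.hasSum hb
  rw [tsum_mul_left] at h3
  rw [← le_div_iff₀ (by positivity)]
  refine h3.trans (le_of_eq ?_)
  rw [zetaTwo]
  field_simp

theorem seminorms_le_of_bound {η : RapidSeq} {p : ℕ} {B : ℝ} (hB : 0 ≤ B)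
    (h : ∀ i, ‖η i‖ * ((i : ℝ) + 1) ^ (p + 1) ≤ B) :
    RapidSeq.seminorms p η ≤ Real.sqrt zetaTwo * B := by
  rw [RapidSeq.seminorms_apply, ← Real.sqrt_sq hB, ← Real.sqrt_mul zetaTwo_nonneg]
  refine Real.sqrt_le_sqrt ?_
  rw [mul_comm zetaTwo, zetaTwo, ← tsum_mul_left]
  refine (mem_rapidSubmodule.1 η.2 p).tsum_le_tsum (fun j => ?_) (summable_inv_sq.mul_left _)
  have h1 := pow_le_pow_left₀ (by positivity) (h j) 2
  rw [← div_eq_mul_inv, le_div_iff₀ (by positivity)]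
  refine le_trans (le_of_eq ?_) h1
  rw [mul_comm 2 (p : ℤ), zpow_mul, zpow_natCast, zpow_ofNat]
  ring

/-- A rapidly decreasing matrix. -/
def RapidKernel (a : ℕ → ℕ → ℂ) : Prop :=
  ∀ q : ℕ, ∃ C : ℝ, ∀ i j : ℕ, ‖a i j‖ * (((i : ℝ) + 1) ^ q * ((j : ℝ) + 1) ^ q) ≤ C

theorem RapidKernel.summable {a : ℕ → ℕ → ℂ} (ha : RapidKernel a) (ξ : SlowSeq) (i : ℕ) :
    Summable fun j => a i j * ξ j := by
  obtain ⟨ξ, q, hq⟩ := ξ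
  obtain ⟨C, hC⟩ := ha (q + 2)
  exact (kernel_summable_and_bound le_rfl hC ⟨ξ, hq⟩ i).1

/-- The linear operator `s' → s` with a given rapidly decreasing matrix. -/
noncomputable def kernelLinearMap {a : ℕ → ℕ → ℂ} (ha : RapidKernel a) :
    SlowSeq →ₗ[ℂ] RapidSeq where
  toFun ξ := ⟨fun i => ∑' j, a i j * ξ j, by
    refine mem_rapidSubmodule_iff_bounded.2 fun m => ?_
    obtain ⟨ξ, q, hq⟩ := ξ
    obtain ⟨C, hC⟩ := ha (max m (q + 2))
    have h := fun i => (kernel_summable_and_bound (le_max_right _ _) hC ⟨ξ, hq⟩ i).2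
    refine ⟨_, fun n => le_trans ?_ (h n)⟩
    gcongr
    · linarith [Nat.cast_nonneg (α := ℝ) n]
    · exact le_max_left _ _⟩
  map_add' ξ η := by
    refine Subtype.ext (funext fun i => ?_)
    change ∑' j, a i j * (ξ j + η j) = ∑' j, a i j * ξ j + ∑' j, a i j * η j
    simp only [mul_add]
    exact (ha.summable ξ i).tsum_add (ha.summable η i)
  map_smul' c ξ := by
    refine Subtype.ext (funext fun i => ?_)
    change ∑' j, a i j * (c * ξ j) = c * ∑' j, a i j * ξ j
    rw [← tsum_mul_left]
    exact tsum_congr fun j => by ring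

theorem seminorms_kernelLinearMap_le {a : ℕ → ℕ → ℂ} (ha : RapidKernel a) {p q r : ℕ} {C : ℝ}
    (hp : p + 1 ≤ r) (hq : q + 2 ≤ r)
    (hC : ∀ i j : ℕ, ‖a i j‖ * (((i : ℝ) + 1) ^ r * ((j : ℝ) + 1) ^ r) ≤ C)
    (ξ : Weighted (-(q : ℤ))) :
    RapidSeq.seminorms p (kernelLinearMap ha (SlowSeq.ofWeighted q ξ)) ≤
      Real.sqrt zetaTwo * zetaTwo * C * ‖ξ‖ := by
  have hC0 : 0 ≤ C := le_trans (by positivity) (hC 0 0)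
  have hz := zetaTwo_nonneg
  rw [mul_assoc, mul_assoc, ← mul_assoc zetaTwo]
  refine seminorms_le_of_bound (by positivity) fun i => ?_
  refine le_trans ?_ (kernel_summable_and_bound hq hC ξ i).2
  refine mul_le_mul_of_nonneg_left ?_ (norm_nonneg _)
  exact pow_le_pow_right₀ (by linarith [Nat.cast_nonneg (α := ℝ) i]) hp

/-- A linear map out of `s'` is continuous if it is so on the Hilbert spaces defining `s'`. -/
theorem SlowSeq.continuous_of_comp_ofWeighted (A : SlowSeq →ₗ[ℂ] RapidSeq)
    (h : ∀ q, Continuous (A ∘ ofWeightedₗ q)) : Continuous A := by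
  -- The topology pulled back from `s` along `A` is one of the locally convex topologies whose
  -- infimum, in the order where smaller means finer, defines `s'`.
  rw [continuous_iff_le_induced]
  refine sInf_le ⟨fun q => continuous_induced_rng.2 (h q), topologicalAddGroup_induced A,
    continuousSMul_induced A, ?_⟩
  exact LocallyConvexSpace.induced (A.restrictScalars ℝ)

/-- The continuous operator `s' → s` with a given rapidly decreasing matrix. -/
noncomputable def kernelOp {a : ℕ → ℕ → ℂ} (ha : RapidKernel a) : SmoothOp where
  toLinearMap := kernelLinearMap ha
  cont := by
    refine SlowSeq.continuous_of_comp_ofWeighted _ fun q => ?_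
    refine RapidSeq.withSeminorms.continuous_of_continuous_comp
      ((kernelLinearMap ha).comp (SlowSeq.ofWeightedₗ q)) fun p => ?_
    obtain ⟨C, hC⟩ := ha (max (p + 1) (q + 2))
    refine Seminorm.continuous_of_le
      (q := (Real.toNNReal (Real.sqrt zetaTwo * zetaTwo * C)) • normSeminorm ℂ _) ?_ ?_
    · change Continuous fun ξ => Real.toNNReal (Real.sqrt zetaTwo * zetaTwo * C) • ‖ξ‖
      fun_prop
    · intro ξ
      refine (seminorms_kernelLinearMap_le ha (le_max_left _ _) (le_max_right _ _) hC ξ).trans ?_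
      change _ ≤ (Real.toNNReal (Real.sqrt zetaTwo * zetaTwo * C) : ℝ) * ‖ξ‖
      gcongr
      exact Real.le_coe_toNNReal _

theorem embed_kernelOp {x : ℓ²(ℕ, ℂ) →L[ℂ] ℓ²(ℕ, ℂ)}
    (ha : RapidKernel fun i j => x (basisVec j) i) : embed (kernelOp ha) = x := by
  refine ContinuousLinearMap.ext fun ξ => ?_
  ext i
  have h1 : embed (kernelOp ha) ξ i = ∑' j, x (basisVec j) i * ξ j := rapidToL2_apply _ _
  rw [h1]
  have h2 := (lp.hasSum_single (p := 2) (by norm_num) ξ).mapL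
    ((innerSL ℂ (basisVec i)).comp x)
  have h3 : ∀ v, (innerSL ℂ (basisVec i)).comp x v = x v i := fun v =>
    inner_basisVec_left i _
  simp only [h3] at h2
  rw [← h2.tsum_eq]
  refine tsum_congr fun j => ?_
  have h4 : (lp.single 2 j (ξ j) : ℓ²(ℕ, ℂ)) = ξ j • basisVec j := by
    rw [basisVec, ← lp.single_smul, smul_eq_mul, mul_one]
  rw [h4, map_smul, mul_comm]
  rfl

theorem isSmooth_iff_entryBound {x : ℓ²(ℕ, ℂ) →L[ℂ] ℓ²(ℕ, ℂ)} :
    IsSmooth x ↔ ∀ q, ∃ C, EntryBound x q C := by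
  constructor
  · rintro ⟨T, rfl⟩ q
    exact ⟨_, entryBound_embed q T⟩
  · intro h
    exact ⟨kernelOp (a := fun i j => x (basisVec j) i) h, embed_kernelOp h⟩

/-- Converse of `entryBound_embed` with a loss of two orders. By injectivity of `embed`, `T` is the
operator built from its own matrix, so the kernel estimate applies to it. -/
theorem smoothNorm_le_of_entryBound {T : SmoothOp} {q : ℕ} {C : ℝ}
    (h : EntryBound (embed T) (q + 2) C) :
    smoothNorm q T ≤ Real.sqrt zetaTwo * zetaTwo * C := by
  have ha : RapidKernel fun i j => embed T (basisVec j) i :=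
    isSmooth_iff_entryBound.1 ⟨T, rfl⟩
  have hT : T = kernelOp ha := embed_injective (embed_kernelOp ha).symm
  have hC0 : 0 ≤ C := le_trans (by positivity) (h 0 0)
  have hz := zetaTwo_nonneg
  refine Real.iSup_le (fun ξ => ?_) (by positivity)
  rw [hT]
  refine (seminorms_kernelLinearMap_le ha (by omega) le_rfl h ξ.1).trans ?_
  exact mul_le_of_le_one_right (by positivity) ξ.2

/-! ### Uniform estimates for spectral projections -/

theorem isStarProjection_norm_apply_le {P : ℓ²(ℕ, ℂ) →L[ℂ] ℓ²(ℕ, ℂ)} (hP : IsStarProjection P)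
    (v : ℓ²(ℕ, ℂ)) : ‖P v‖ ≤ ‖v‖ := by
  simpa using P.le_of_opNorm_le hP.norm_le v

/-- Interpolation for the matrix of a contraction. -/
theorem EntryBound.of_pow {P : ℓ²(ℕ, ℂ) →L[ℂ] ℓ²(ℕ, ℂ)} (hP : IsStarProjection P) {q k : ℕ}
    (hk : k ≠ 0) {D : ℝ} (hD : 0 ≤ D) (h : EntryBound P (k * q) (D ^ k)) : EntryBound P q D := by
  intro i j
  have h1 : ‖P (basisVec j) i‖ ≤ 1 := (norm_coord_le _ _).trans
    ((isStarProjection_norm_apply_le hP _).trans (norm_basisVec j).le)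
  refine (pow_le_pow_iff_left₀ (by positivity) hD hk).1 (le_trans ?_ (h i j))
  rw [mul_comm k q, pow_mul, pow_mul, mul_pow, mul_pow]
  gcongr
  -- An entry of modulus at most 1 dominates its own `k`-th power.
  exact pow_le_of_le_one (norm_nonneg (P (basisVec j) i)) h1 hk

/-- Interpolation at the level of norms. The constants do not depend on the projection, so the bound
can be used along a whole sequence `P_n`. -/
theorem exists_smoothNorm_pow_le (q k : ℕ) (hk : k ≠ 0) : ∃ K : ℝ, ∃ r : ℕ, 0 ≤ K ∧
    ∀ T : SmoothOp, IsStarProjection (embed T) →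
      smoothNorm q T ^ k ≤ K * smoothNorm r T := by
  have hz := zetaTwo_nonneg
  refine ⟨(Real.sqrt zetaTwo * zetaTwo) ^ k, k * (q + 2), by positivity, fun T hT => ?_⟩
  have h0 := smoothNorm_nonneg (k * (q + 2)) T
  have hD : (smoothNorm (k * (q + 2)) T ^ (k : ℝ)⁻¹) ^ k = smoothNorm (k * (q + 2)) T :=
    Real.rpow_inv_natCast_pow h0 hk
  have h1 := entryBound_embed (k * (q + 2)) T
  rw [← hD] at h1
  have h2 := smoothNorm_le_of_entryBound (h1.of_pow hT hk (by positivity))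
  have h3 := pow_le_pow_left₀ (smoothNorm_nonneg q T) h2 k
  rwa [mul_pow, hD] at h3

theorem IsSmooth.adjoint {x : ℓ²(ℕ, ℂ) →L[ℂ] ℓ²(ℕ, ℂ)} (hx : IsSmooth x) :
    IsSmooth (ContinuousLinearMap.adjoint x) := by
  rw [isSmooth_iff_entryBound] at hx ⊢
  intro q
  obtain ⟨C, hC⟩ := hx q
  refine ⟨C, fun i j => ?_⟩
  rw [← inner_basisVec_left, ContinuousLinearMap.adjoint_inner_right, norm_inner_symm,
    inner_basisVec_left, mul_comm (_ ^ q)]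
  exact hC j i

theorem IsSmooth.exists_norm_apply_basisVec_le {x : ℓ²(ℕ, ℂ) →L[ℂ] ℓ²(ℕ, ℂ)} (hx : IsSmooth x)
    (q : ℕ) : ∃ C : ℝ, ∀ j, ‖x (basisVec j)‖ * ((j : ℝ) + 1) ^ q ≤ C := by
  obtain ⟨T, rfl⟩ := hx
  exact ⟨_, norm_apply_basisVec_mul_le q T⟩

/-- Spectral projections satisfy `λ² P = x P x`, which bounds their matrices. -/
theorem IsSmooth.exists_entry_bound {x : ℓ²(ℕ, ℂ) →L[ℂ] ℓ²(ℕ, ℂ)} (hx : IsSmooth x) (q : ℕ) :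
    ∃ C : ℝ, ∀ (P : ℓ²(ℕ, ℂ) →L[ℂ] ℓ²(ℕ, ℂ)) (l : ℂ), IsStarProjection P → l ≠ 0 →
      x.comp P = l • P → P.comp x = l • P → EntryBound P q (C / ‖l‖ ^ 2) := by
  obtain ⟨A, hA⟩ := hx.exists_norm_apply_basisVec_le q
  obtain ⟨B, hB⟩ := hx.adjoint.exists_norm_apply_basisVec_le q
  refine ⟨B * A, fun P l hP hl h1 h2 i j => ?_⟩
  have hl' : 0 < ‖l‖ := norm_pos_iff.2 hl
  have h3 : x (P (x (basisVec j))) = (l * l) • P (basisVec j) := by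
    have e1 : P (x (basisVec j)) = l • P (basisVec j) := DFunLike.congr_fun h2 (basisVec j)
    have e2 : x (P (basisVec j)) = l • P (basisVec j) := DFunLike.congr_fun h1 (basisVec j)
    rw [e1, map_smul, e2, smul_smul]
  have h4 : ‖l‖ ^ 2 * ‖P (basisVec j) i‖ ≤
      ‖ContinuousLinearMap.adjoint x (basisVec i)‖ * ‖x (basisVec j)‖ := by
    have h5 : ‖l‖ ^ 2 * ‖P (basisVec j) i‖ = ‖x (P (x (basisVec j))) i‖ := by
      rw [h3, sq, ← norm_mul, ← norm_mul]
      rfl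
    -- Write the entry of `x P x` as `⟨x* e_i, P x e_j⟩`; Cauchy–Schwarz and `‖P‖ ≤ 1` then separate
    -- the decay in `i` from the decay in `j`.
    rw [h5, ← inner_basisVec_left, ← ContinuousLinearMap.adjoint_inner_left]
    exact (norm_inner_le_norm _ _).trans
      (mul_le_mul_of_nonneg_left (isStarProjection_norm_apply_le hP _) (norm_nonneg _))
  rw [le_div_iff₀ (by positivity)]
  have hB0 : 0 ≤ B := le_trans (by positivity) (hB 0)
  calc ‖P (basisVec j) i‖ * (((i : ℝ) + 1) ^ q * ((j : ℝ) + 1) ^ q) * ‖l‖ ^ 2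
      = (‖l‖ ^ 2 * ‖P (basisVec j) i‖) * (((i : ℝ) + 1) ^ q * ((j : ℝ) + 1) ^ q) := by ring
    _ ≤ (‖ContinuousLinearMap.adjoint x (basisVec i)‖ * ‖x (basisVec j)‖) *
          (((i : ℝ) + 1) ^ q * ((j : ℝ) + 1) ^ q) := by gcongr
    _ = (‖ContinuousLinearMap.adjoint x (basisVec i)‖ * ((i : ℝ) + 1) ^ q) *
          (‖x (basisVec j)‖ * ((j : ℝ) + 1) ^ q) := by ring
    _ ≤ B * A := mul_le_mul (hB i) (hA j) (by positivity) hB0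

theorem IsSmooth.isSmooth_projection {x P : ℓ²(ℕ, ℂ) →L[ℂ] ℓ²(ℕ, ℂ)} (hx : IsSmooth x) {l : ℂ}
    (hP : IsStarProjection P) (hl : l ≠ 0) (h1 : x.comp P = l • P) (h2 : P.comp x = l • P) :
    IsSmooth P := by
  refine isSmooth_iff_entryBound.2 fun q => ?_
  obtain ⟨C, hC⟩ := hx.exists_entry_bound q
  exact ⟨_, hC P l hP hl h1 h2⟩

theorem IsSmooth.exists_smoothNorm_bound {x : ℓ²(ℕ, ℂ) →L[ℂ] ℓ²(ℕ, ℂ)} (hx : IsSmooth x)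
    (q : ℕ) : ∃ C : ℝ, ∀ (T : SmoothOp) (l : ℂ), IsStarProjection (embed T) → l ≠ 0 →
      x.comp (embed T) = l • embed T → (embed T).comp x = l • embed T →
      ‖l‖ ^ 2 * smoothNorm q T ≤ C := by
  obtain ⟨C, hC⟩ := hx.exists_entry_bound (q + 2)
  refine ⟨Real.sqrt zetaTwo * zetaTwo * C, fun T l hT hl h1 h2 => ?_⟩
  have hl' : 0 < ‖l‖ := norm_pos_iff.2 hl
  have h := smoothNorm_le_of_entryBound (hC _ l hT hl h1 h2)
  rw [← mul_div_assoc, le_div_iff₀ (by positivity)] at h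
  linarith

/-! ### Decay of the eigenvalues -/

theorem IsSpectralSystem.exists_orthonormal {ι : Type*} {lam : ι → ℂ}
    {P : ι → ℓ²(ℕ, ℂ) →L[ℂ] ℓ²(ℕ, ℂ)} (h : IsSpectralSystem lam P) :
    ∃ v : ι → ℓ²(ℕ, ℂ), Orthonormal ℂ v ∧ ∀ n, P n (v n) = v n := by
  have hex : ∀ n, ∃ w, P n w = w ∧ ‖w‖ = 1 := by
    intro n
    obtain ⟨u, hu⟩ : ∃ u, P n u ≠ 0 := by
      by_contra! hc
      exact h.P_ne_zero n (ContinuousLinearMap.ext hc)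
    have h2 : P n (P n u) = P n u :=
      congrArg (fun A : ℓ²(ℕ, ℂ) →L[ℂ] ℓ²(ℕ, ℂ) => A u) (h.isProj n).isIdempotentElem
    refine ⟨((‖P n u‖⁻¹ : ℝ) : ℂ) • P n u, by rw [map_smul, h2], ?_⟩
    rw [norm_smul, Complex.norm_real, norm_inv, norm_norm, inv_mul_cancel₀ (norm_ne_zero_iff.2 hu)]
  choose v hv hn using hex
  refine ⟨v, ⟨hn, fun m n hmn => ?_⟩, hv⟩
  have h1 : inner ℂ (P m (v m)) (v n) = inner ℂ (v m) (P m (v n)) :=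
    (h.isProj m).isSelfAdjoint.isSymmetric (v m) (v n)
  have h2 : P m (P n (v n)) = 0 := DFunLike.congr_fun (h.orthogonal m n hmn) (v n)
  rw [hv n] at h2
  rw [hv m, h2, inner_zero_right] at h1
  exact h1

/-- The eigenvalues of a smooth operator are rapidly decreasing. -/
theorem IsSmooth.eigenvalues_rapid {x : ℓ²(ℕ, ℂ) →L[ℂ] ℓ²(ℕ, ℂ)} (hx : IsSmooth x)
    {lam : ℕ → ℂ} {P : ℕ → ℓ²(ℕ, ℂ) →L[ℂ] ℓ²(ℕ, ℂ)} (h : IsSpectralSystem lam P)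
    (hanti : Antitone fun n => ‖lam n‖) (hPx : ∀ n, (P n).comp x = lam n • P n) :
    lam ∈ rapidSubmodule := by
  refine mem_rapidSubmodule_iff_bounded.2 fun m => ?_
  have hz := zetaTwo_nonneg
  obtain ⟨C, hC⟩ := hx.exists_norm_apply_basisVec_le (2 * (m + 1))
  have hC0 : 0 ≤ C := le_trans (by positivity) (hC 0)
  obtain ⟨v, hv, hPv⟩ := h.exists_orthonormal
  refine ⟨zetaTwo ^ (m + 1) * C, fun n => ?_⟩
  have hl : 0 < ‖lam n‖ := norm_pos_iff.2 (h.lam_ne_zero n)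
  -- Squared norm of the projection of `e_i` onto the span of `v_0, …, v_n`. Bessel for `e_i` bounds
  -- it by 1; Bessel for `x e_i` bounds it by `‖x e_i‖² / |λ_n|²`; summing over `i` counts the `n +
  -- 1` vectors.
  set a : ℕ → ℝ := fun i => ∑ k ∈ Finset.range (n + 1), ‖v k i‖ ^ 2 with ha
  have ha0 : ∀ i, 0 ≤ a i := fun i => Finset.sum_nonneg fun _ _ => by positivity
  have ha1 : ∀ i, a i ≤ 1 := by
    intro i
    have := hv.sum_inner_products_le (basisVec i) (s := Finset.range (n + 1))
    simp only [norm_inner_symm _ (basisVec i), inner_basisVec_left, norm_basisVec, one_pow] at this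
    exact this
  have ha2 : ∀ i, ‖lam n‖ ^ 2 * a i ≤ ‖x (basisVec i)‖ ^ 2 := by
    intro i
    refine le_trans ?_ (hv.sum_inner_products_le (x (basisVec i)) (s := Finset.range (n + 1)))
    rw [ha, Finset.mul_sum]
    refine Finset.sum_le_sum fun k hk => ?_
    have hk' : ‖lam n‖ ≤ ‖lam k‖ := hanti (by simpa [Nat.lt_succ_iff] using hk)
    have e1 : ∀ w, inner ℂ (v k) w = inner ℂ (v k) (P k w) := by
      intro w
      have : inner ℂ (P k (v k)) w = inner ℂ (v k) (P k w) :=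
        (h.isProj k).isSelfAdjoint.isSymmetric (v k) w
      rwa [hPv k] at this
    have e2 : P k (x (basisVec i)) = lam k • P k (basisVec i) :=
      DFunLike.congr_fun (hPx k) (basisVec i)
    rw [e1, e2, inner_smul_right, ← e1, norm_mul, norm_inner_symm, inner_basisVec_left, mul_pow]
    gcongr
  have hsum : HasSum a (n + 1) := by
    have := hasSum_sum (s := Finset.range (n + 1)) fun k _ => hasSum_sq_norm (v k)
    simpa [hv.1] using this
  -- The root is chosen so that `n + 1 ≤ R ζ(2)`, raised to the power `m + 1`, becomes linear in `1
  -- / |λ_n|`.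
  set R : ℝ := (C / ‖lam n‖) ^ ((m + 1 : ℕ) : ℝ)⁻¹
  have hRp : R ^ (m + 1) = C / ‖lam n‖ := Real.rpow_inv_natCast_pow (by positivity) (by omega)
  have hR0 : 0 ≤ R := by positivity
  have ha3 : ∀ i, a i ≤ R * (((i : ℝ) + 1) ^ 2)⁻¹ := by
    intro i
    rw [← div_eq_mul_inv, le_div_iff₀ (by positivity)]
    refine (pow_le_pow_iff_left₀ (mul_nonneg (ha0 i) (by positivity)) hR0
      (show 2 * (m + 1) ≠ 0 by omega)).1 ?_
    rw [mul_comm 2 (m + 1), pow_mul R, hRp, div_pow, le_div_iff₀ (by positivity), mul_pow]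
    calc a i ^ ((m + 1) * 2) * (((i : ℝ) + 1) ^ 2) ^ ((m + 1) * 2) * ‖lam n‖ ^ 2
        ≤ a i * (((i : ℝ) + 1) ^ 2) ^ ((m + 1) * 2) * ‖lam n‖ ^ 2 := by
          gcongr
          exact pow_le_of_le_one (ha0 i) (ha1 i) (by omega)
      _ = (‖lam n‖ ^ 2 * a i) * (((i : ℝ) + 1) ^ (2 * (m + 1))) ^ 2 := by
          rw [← pow_mul, ← pow_mul, mul_assoc 2]
          ring
      _ ≤ ‖x (basisVec i)‖ ^ 2 * (((i : ℝ) + 1) ^ (2 * (m + 1))) ^ 2 := by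
          gcongr
          exact ha2 i
      _ = (‖x (basisVec i)‖ * ((i : ℝ) + 1) ^ (2 * (m + 1))) ^ 2 := by ring
      _ ≤ C ^ 2 := by
          gcongr
          exact hC i
  have h4 : (n : ℝ) + 1 ≤ R * zetaTwo := by
    rw [← hsum.tsum_eq, zetaTwo, ← tsum_mul_left]
    exact hsum.summable.tsum_le_tsum ha3 (summable_inv_sq.mul_left R)
  have h5 := pow_le_pow_left₀ (by positivity) h4 (m + 1)
  rw [mul_pow, hRp, div_mul_eq_mul_div, le_div_iff₀ hl] at h5
  calc ‖lam n‖ * ((n : ℝ) + 1) ^ m ≤ ‖lam n‖ * ((n : ℝ) + 1) ^ (m + 1) := by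
        gcongr
        · linarith [Nat.cast_nonneg (α := ℝ) n]
        · omega
    _ ≤ zetaTwo ^ (m + 1) * C := by linarith

/-! ### Products of spectral sums with their projections -/

theorem IsSpectralSystem.sum_comp {ι : Type*} {lam : ι → ℂ}
    {P : ι → ℓ²(ℕ, ℂ) →L[ℂ] ℓ²(ℕ, ℂ)} (h : IsSpectralSystem lam P) (s : Finset ι) {n : ι}
    (hn : n ∈ s) : (∑ k ∈ s, lam k • P k).comp (P n) = lam n • P n := by
  rw [ContinuousLinearMap.finsetSum_comp, Finset.sum_eq_single_of_mem n hn]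
  · rw [ContinuousLinearMap.smul_comp]
    exact congrArg (lam n • ·) (h.isProj n).isIdempotentElem
  · intro k _ hk
    rw [ContinuousLinearMap.smul_comp, h.orthogonal k n hk, smul_zero]

theorem IsSpectralSystem.comp_sum {ι : Type*} {lam : ι → ℂ}
    {P : ι → ℓ²(ℕ, ℂ) →L[ℂ] ℓ²(ℕ, ℂ)} (h : IsSpectralSystem lam P) (s : Finset ι) {n : ι}
    (hn : n ∈ s) : (P n).comp (∑ k ∈ s, lam k • P k) = lam n • P n := by
  rw [ContinuousLinearMap.comp_finsetSum, Finset.sum_eq_single_of_mem n hn]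
  · rw [ContinuousLinearMap.comp_smul]
    exact congrArg (lam n • ·) (h.isProj n).isIdempotentElem
  · intro k _ hk
    rw [ContinuousLinearMap.comp_smul, h.orthogonal n k hk.symm, smul_zero]

section Limit

variable {x : ℓ²(ℕ, ℂ) →L[ℂ] ℓ²(ℕ, ℂ)} {lam : ℕ → ℂ} {P : ℕ → ℓ²(ℕ, ℂ) →L[ℂ] ℓ²(ℕ, ℂ)}

theorem IsSpectralSystem.limit_comp (h : IsSpectralSystem lam P)
    (hx : Filter.Tendsto (fun N => ∑ n ∈ Finset.range N, lam n • P n) Filter.atTop (𝓝 x))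
    (n : ℕ) : x.comp (P n) = lam n • P n := by
  refine tendsto_nhds_unique (hx.mul_const (P n)) (tendsto_const_nhds.congr' ?_)
  filter_upwards [Filter.eventually_gt_atTop n] with N hN
  exact (h.sum_comp _ (Finset.mem_range.2 hN)).symm

theorem IsSpectralSystem.comp_limit (h : IsSpectralSystem lam P)
    (hx : Filter.Tendsto (fun N => ∑ n ∈ Finset.range N, lam n • P n) Filter.atTop (𝓝 x))
    (n : ℕ) : (P n).comp x = lam n • P n := by
  refine tendsto_nhds_unique (hx.const_mul (P n)) (tendsto_const_nhds.congr' ?_)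
  filter_upwards [Filter.eventually_gt_atTop n] with N hN
  exact (h.comp_sum _ (Finset.mem_range.2 hN)).symm

end Limit

/-! ### The estimates behind the implications -/

/-- The norm `‖·‖_0` dominates the size of the operator on `ℓ²`, and a nonzero projection fixes a
nonzero vector. -/
theorem one_le_smoothNorm_zero {T : SmoothOp} (hT : IsStarProjection (embed T))
    (h0 : embed T ≠ 0) : 1 ≤ smoothNorm 0 T := by
  obtain ⟨u, hu⟩ : ∃ u, embed T u ≠ 0 := by
    by_contra! hc
    exact h0 (ContinuousLinearMap.ext hc)
  have h2 : embed T (embed T u) = embed T u :=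
    congrArg (fun A : ℓ²(ℕ, ℂ) →L[ℂ] ℓ²(ℕ, ℂ) => A u) hT.isIdempotentElem
  set w := embed T u
  have h3 := seminorms_le_smoothNorm 0 T (l2ToWeighted w)
  have h4 : ‖l2ToWeighted w‖ = ‖w‖ := by
    rw [← Weighted.norm_toL2]
    congr 1
    ext j
    change ((j : ℂ) + 1) ^ (-((0 : ℕ) : ℤ)) * w j = w j
    simp
  have h5 : ‖embed T w‖ ≤ RapidSeq.seminorms 0 (T (SlowSeq.ofWeighted 0 (l2ToWeighted w))) :=
    norm_rapidToL2_le 0 _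
  rw [h2] at h5
  rw [h4] at h3
  have h6 := norm_pos_iff.2 hu
  exact le_of_mul_le_mul_right (by linarith) h6

theorem le_one_add_of_pow_le {y B : ℝ} {k : ℕ} (hy : 0 ≤ y) (hk : k ≠ 0) (h : y ^ k ≤ B) :
    y ≤ 1 + B := by
  have hB : 0 ≤ B := le_trans (by positivity) h
  rcases le_total y 1 with h1 | h1
  · linarith
  · linarith [le_self_pow₀ h1 hk]

theorem IsSmooth.rpow_mul_smoothNorm_rapid {x : ℓ²(ℕ, ℂ) →L[ℂ] ℓ²(ℕ, ℂ)} (hx : IsSmooth x)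
    {lam : ℕ → ℂ} {T : ℕ → SmoothOp} (hlam : lam ∈ rapidSubmodule)
    (h : IsSpectralSystem lam fun n => embed (T n))
    (h1 : ∀ n, x.comp (embed (T n)) = lam n • embed (T n))
    (h2 : ∀ n, (embed (T n)).comp x = lam n • embed (T n)) (q : ℕ) {θ : ℝ} (hθ : 0 < θ) :
    (fun n => ((‖lam n‖ ^ θ * smoothNorm q (T n) : ℝ) : ℂ)) ∈ rapidSubmodule := by
  refine mem_rapidSubmodule_iff_bounded.2 fun m => ?_
  -- With `kθ > 3`, `|λ|^{kθ}` splits into `|λ|^{kθ-3}`, which is bounded, `|λ|`, which supplies the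
  -- decay in `n`, and `|λ|²`, which absorbs `‖P_n‖_r`.
  obtain ⟨k, hk⟩ := exists_nat_gt (3 / θ)
  rw [div_lt_iff₀ hθ] at hk
  have hk0 : k ≠ 0 := by
    rintro rfl
    norm_num at hk
  obtain ⟨K, r, hK0, hK⟩ := exists_smoothNorm_pow_le q k hk0
  obtain ⟨C, hC⟩ := hx.exists_smoothNorm_bound r
  obtain ⟨A, hA⟩ := mem_rapidSubmodule_iff_bounded.1 hlam (m * k)
  obtain ⟨L, hL⟩ := mem_rapidSubmodule_iff_bounded.1 hlam 0
  simp only [pow_zero, mul_one] at hL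
  have hL0 : 0 ≤ L := le_trans (norm_nonneg _) (hL 0)
  have hA0 : 0 ≤ A := le_trans (by positivity) (hA 0)
  refine ⟨1 + L ^ (k * θ - 3) * A * (K * C), fun n => ?_⟩
  have hs := smoothNorm_nonneg q (T n)
  have hr := smoothNorm_nonneg r (T n)
  have hl : 0 < ‖lam n‖ := norm_pos_iff.2 (h.lam_ne_zero n)
  rw [Complex.norm_real, Real.norm_of_nonneg (by positivity)]
  refine le_one_add_of_pow_le (by positivity) hk0 ?_
  have e : (‖lam n‖ ^ θ) ^ k = ‖lam n‖ ^ (k * θ - 3) * ‖lam n‖ * ‖lam n‖ ^ 2 := by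
    rw [← Real.rpow_mul_natCast hl.le, mul_assoc, ← pow_succ', ← Real.rpow_natCast,
      ← Real.rpow_add hl]
    congr 1
    push_cast
    ring
  rw [mul_pow, mul_pow, e]
  calc ‖lam n‖ ^ (k * θ - 3) * ‖lam n‖ * ‖lam n‖ ^ 2 * smoothNorm q (T n) ^ k *
        (((n : ℝ) + 1) ^ m) ^ k
      = ‖lam n‖ ^ (k * θ - 3) * (‖lam n‖ * ((n : ℝ) + 1) ^ (m * k)) *
          (‖lam n‖ ^ 2 * smoothNorm q (T n) ^ k) := by ring
    _ ≤ L ^ (k * θ - 3) * A * (K * C) := by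
      refine mul_le_mul (mul_le_mul (Real.rpow_le_rpow hl.le (hL n) (by linarith)) (hA n)
        (by positivity) (by positivity)) ?_ (by positivity) (by positivity)
      calc ‖lam n‖ ^ 2 * smoothNorm q (T n) ^ k
          ≤ ‖lam n‖ ^ 2 * (K * smoothNorm r (T n)) := by
            gcongr
            exact hK _ (h.isProj n)
        _ = K * (‖lam n‖ ^ 2 * smoothNorm r (T n)) := by ring
        _ ≤ K * C := by
            gcongr
            exact hC _ _ (h.isProj n) (h.lam_ne_zero n) (h1 n) (h2 n)

theorem summable_mul_smoothNorm {lam : ℕ → ℂ} {T : ℕ → SmoothOp} (hlam : lam ∈ rapidSubmodule)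
    (hT : ∀ n, IsStarProjection (embed (T n)))
    (hb : ∀ q : ℕ, BddAbove (Set.range fun n => ‖lam n‖ * smoothNorm q (T n))) (q : ℕ) :
    Summable fun n => ‖lam n‖ * smoothNorm q (T n) := by
  obtain ⟨K, r, hK0, hK⟩ := exists_smoothNorm_pow_le q 2 two_ne_zero
  obtain ⟨C, hC⟩ := hb r
  -- The target is a bound by a multiple of `(n + 1)⁻²`; after squaring, this needs four powers of
  -- `n + 1`.
  obtain ⟨A, hA⟩ := mem_rapidSubmodule_iff_bounded.1 hlam 4
  have hA0 : 0 ≤ A := le_trans (by positivity) (hA 0)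
  refine Summable.of_nonneg_of_le (fun n => mul_nonneg (norm_nonneg _) (smoothNorm_nonneg _ _))
    (fun n => ?_) (summable_inv_sq.mul_left (1 + A * (K * C)))
  have hs := smoothNorm_nonneg q (T n)
  rw [← div_eq_mul_inv, le_div_iff₀ (by positivity)]
  refine le_one_add_of_pow_le (by positivity) two_ne_zero ?_
  calc (‖lam n‖ * smoothNorm q (T n) * ((n : ℝ) + 1) ^ 2) ^ 2
      = (‖lam n‖ * ((n : ℝ) + 1) ^ 4) * (‖lam n‖ * smoothNorm q (T n) ^ 2) := by ring
    _ ≤ A * (K * C) := by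
      refine mul_le_mul (hA n) ?_ (by positivity) hA0
      calc ‖lam n‖ * smoothNorm q (T n) ^ 2 ≤ ‖lam n‖ * (K * smoothNorm r (T n)) := by
            gcongr
            exact hK _ (hT n)
        _ = K * (‖lam n‖ * smoothNorm r (T n)) := by ring
        _ ≤ K * C := by
            gcongr
            exact hC ⟨n, rfl⟩

/-- Norm convergence on `ℓ²` implies convergence of each matrix entry, and the sum of the series
bounds the weighted entries of all partial sums. -/
theorem isSmooth_of_summable {x : ℓ²(ℕ, ℂ) →L[ℂ] ℓ²(ℕ, ℂ)} {lam : ℕ → ℂ} {T : ℕ → SmoothOp}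
    (hx : Filter.Tendsto (fun N => ∑ n ∈ Finset.range N, lam n • embed (T n))
      Filter.atTop (𝓝 x))
    (hs : ∀ q : ℕ, Summable fun n => ‖lam n‖ * smoothNorm q (T n)) : IsSmooth x := by
  refine isSmooth_iff_entryBound.2 fun q => ⟨∑' n, ‖lam n‖ * smoothNorm q (T n), fun i j => ?_⟩
  let φ : (ℓ²(ℕ, ℂ) →L[ℂ] ℓ²(ℕ, ℂ)) →L[ℂ] ℂ :=
    (innerSL ℂ (basisVec i)).comp (ContinuousLinearMap.apply ℂ ℓ²(ℕ, ℂ) (basisVec j))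
  have hφ : ∀ y, φ y = y (basisVec j) i := fun y => inner_basisVec_left i _
  have h1 := (((φ.continuous.tendsto x).comp hx).norm).mul_const
    (((i : ℝ) + 1) ^ q * ((j : ℝ) + 1) ^ q)
  rw [hφ] at h1
  refine le_of_tendsto' h1 fun N => ?_
  rw [Function.comp_apply, map_sum]
  simp only [hφ]
  calc ‖∑ n ∈ Finset.range N, lam n • embed (T n) (basisVec j) i‖ *
        (((i : ℝ) + 1) ^ q * ((j : ℝ) + 1) ^ q)
      ≤ (∑ n ∈ Finset.range N, ‖lam n • embed (T n) (basisVec j) i‖) *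
        (((i : ℝ) + 1) ^ q * ((j : ℝ) + 1) ^ q) := by
          gcongr
          exact norm_sum_le _ _
    _ = ∑ n ∈ Finset.range N, ‖lam n‖ * (‖embed (T n) (basisVec j) i‖ *
        (((i : ℝ) + 1) ^ q * ((j : ℝ) + 1) ^ q)) := by
          rw [Finset.sum_mul]
          exact Finset.sum_congr rfl fun n _ => by rw [norm_smul, mul_assoc]
    _ ≤ ∑ n ∈ Finset.range N, ‖lam n‖ * smoothNorm q (T n) := by
          gcongr with n
          exact entryBound_embed q (T n) i j
    _ ≤ ∑' n, ‖lam n‖ * smoothNorm q (T n) :=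
          (hs q).sum_le_tsum _ fun n _ => mul_nonneg (norm_nonneg _) (smoothNorm_nonneg _ _)

/-- `embed` as a linear map. -/
noncomputable def embedₗ : SmoothOp →ₗ[ℂ] (ℓ²(ℕ, ℂ) →L[ℂ] ℓ²(ℕ, ℂ)) where
  toFun := embed
  map_add' T S := by
    refine ContinuousLinearMap.ext fun ξ => ?_
    exact map_add rapidToL2 _ _
  map_smul' c T := by
    refine ContinuousLinearMap.ext fun ξ => ?_
    exact map_smul rapidToL2 c _

theorem isSmooth_sum {ι : Type*} [Fintype ι] (lam : ι → ℂ)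
    {P : ι → ℓ²(ℕ, ℂ) →L[ℂ] ℓ²(ℕ, ℂ)} (h : ∀ n, IsSmooth (P n)) :
    IsSmooth (∑ n, lam n • P n) :=
  Submodule.sum_mem (LinearMap.range embedₗ) fun n _ => Submodule.smul_mem _ _ (h n)

end SmoothOperators

/-! ### The equivalences and the finite-dimensional case -/

theorem mainTheorem5 :
    -- the infinite-dimensional case
    (∀ (x : ℓ²(ℕ, ℂ) →L[ℂ] ℓ²(ℕ, ℂ)) (lam : ℕ → ℂ) (P : ℕ → ℓ²(ℕ, ℂ) →L[ℂ] ℓ²(ℕ, ℂ)),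
      IsCompactOperator x → IsStarNormal x →
      ¬ FiniteDimensional ℂ (LinearMap.range x.toLinearMap) →
      IsSpectralSystem lam P → Antitone (fun n => ‖lam n‖) →
      Filter.Tendsto (fun N => ∑ n ∈ Finset.range N, lam n • P n) Filter.atTop (𝓝 x) →
      List.TFAE [
        IsSmooth x,
        ∃ T : ℕ → SmoothOp, (∀ n, embed (T n) = P n) ∧
          ∀ (q : ℕ) (θ : ℝ), 0 < θ → θ ≤ 1 →
            (fun n => ((‖lam n‖ ^ θ * smoothNorm q (T n) : ℝ) : ℂ)) ∈ rapidSubmodule,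
        ∃ T : ℕ → SmoothOp, (∀ n, embed (T n) = P n) ∧ lam ∈ rapidSubmodule ∧
          ∀ q : ℕ, BddAbove (Set.range fun n => ‖lam n‖ * smoothNorm q (T n)),
        ∃ T : ℕ → SmoothOp, (∀ n, embed (T n) = P n) ∧
          ∀ q : ℕ, Summable fun n => ‖lam n‖ * smoothNorm q (T n)]) ∧
    -- the finite-dimensional case
    (∀ (N : ℕ) (x : ℓ²(ℕ, ℂ) →L[ℂ] ℓ²(ℕ, ℂ)) (lam : Fin N → ℂ)
      (P : Fin N → ℓ²(ℕ, ℂ) →L[ℂ] ℓ²(ℕ, ℂ)),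
      IsSpectralSystem lam P → x = ∑ n, lam n • P n →
      (IsSmooth x ↔ ∀ n, IsSmooth (P n))) := by
  refine ⟨fun x lam P _ _ _ hS hanti hx => ?_, fun N x lam P hS hx => ⟨fun h n => ?_, fun h => ?_⟩⟩
  · have h1 := hS.limit_comp hx
    have h2 := hS.comp_limit hx
    tfae_have 1 → 2 := by
      intro h
      choose T hT using fun n =>
        h.isSmooth_projection (hS.isProj n) (hS.lam_ne_zero n) (h1 n) (h2 n)
      refine ⟨T, hT, fun q θ hθ _ => ?_⟩
      have hlam := h.eigenvalues_rapid hS hanti h2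
      obtain rfl : (fun n => embed (T n)) = P := funext hT
      exact h.rpow_mul_smoothNorm_rapid hlam hS h1 h2 q hθ
    tfae_have 2 → 3 := by
      rintro ⟨T, hT, h⟩
      obtain rfl : (fun n => embed (T n)) = P := funext hT
      have hb : ∀ q m : ℕ, ∃ C : ℝ, ∀ n : ℕ,
          ‖lam n‖ * smoothNorm q (T n) * ((n : ℝ) + 1) ^ m ≤ C := by
        intro q m
        -- Only `θ = 1` is needed here.
        obtain ⟨C, hC⟩ := mem_rapidSubmodule_iff_bounded.1 (h q 1 one_pos le_rfl) m
        refine ⟨C, fun n => ?_⟩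
        have := hC n
        rwa [Complex.norm_real, Real.rpow_one, Real.norm_of_nonneg
          (mul_nonneg (norm_nonneg _) (smoothNorm_nonneg _ _))] at this
      refine ⟨T, hT, mem_rapidSubmodule_iff_bounded.2 fun m => ?_, fun q => ?_⟩
      · obtain ⟨C, hC⟩ := hb 0 m
        refine ⟨C, fun n => le_trans ?_ (hC n)⟩
        gcongr
        exact le_mul_of_one_le_right (norm_nonneg _)
          (one_le_smoothNorm_zero (hS.isProj n) (hS.P_ne_zero n))
      · obtain ⟨C, hC⟩ := hb q 0
        refine ⟨C, ?_⟩
        rintro _ ⟨n, rfl⟩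
        simpa using hC n
    tfae_have 3 → 4 := by
      rintro ⟨T, hT, hlam, hb⟩
      exact ⟨T, hT, summable_mul_smoothNorm hlam (fun n => hT n ▸ hS.isProj n) hb⟩
    tfae_have 4 → 1 := by
      rintro ⟨T, hT, hs⟩
      obtain rfl : (fun n => embed (T n)) = P := funext hT
      exact isSmooth_of_summable hx hs
    tfae_finish
  · exact h.isSmooth_projection (hS.isProj n) (hS.lam_ne_zero n)
      (by rw [hx]; exact hS.sum_comp _ (Finset.mem_univ n))
      (by rw [hx]; exact hS.comp_sum _ (Finset.mem_univ n))
  · rw [hx]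
    exact isSmooth_sum lam h
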